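/- For integers $1\le k<n$ let $P_n^k$ be the $k$th power of the directed path $v_n\to v_{n-1}\to\dots\to v_1$, that is, the directed graph on $\{v_1,\dots,v_n\}$ with an edge from $v_i$ to another vertex $v_j$ if and only if the path contains a directed path from $v_i$ to $v_j$ with at most $k+1$ vertices (equivalently $1\le i-j\le k$). Its only sink (vertex without outgoing edges) is $\mathbb 1=v_1$. Let $\pi=(\pi_1,\dots,\pi_n)$ be a uniformly random permutation of the vertices, and for $1\le t\le n$ let $P_{(t)}$ be the subgraph of $P_n^k$ induced by $\{\pi_1,\dots,\pi_t\}$, let $c(P_{(t)})$ be the number of its connected components (directions ignored), and let $b_t$ be the number of vertices outside $\{\pi_1,\dots,\pi_t\}$ that lie, in the order of the underlying path, between the two extreme vertices of some component of $P_{(t)}$. Let $$\tau_n=\tau_n(\pi)=\min\{t\le n:\ n-t=k\,(c(P_{(t)})-1)+b_t\ \text{ and }\ \pi_t\text{ is a sink of }P_{(t)}\},\qquad \min\emptyset=n.$$ (a) There is a constant $C>0$, namely $C=\Gamma(4/3)\,3^{1/3}\approx 1.29$ (rounded to two decimals, that is, $|C-1.29|<0.005$), such that for every choice of $k=k(n)$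 with $1\le k(n)<n$ for all $n\ge 2$, $$\limsup_{n\to\infty} n^{1/(k(n)+1)}\,\mathbb P[\pi_{\tau_n}=\mathbb 1]\le C,$$ where $\tau_n$ and the probability refer to $P_n^{k(n)}$. (b) For all integers $n,k$ with $1\le k<n-2$, with $m=\lfloor (n-2)/(k+1)\rfloor$ (so $m\ge1$) and $B(a,b)=\int_0^1x^{a-1}(1-x)^{b-1}\,dx$, $$\mathbb P[\pi_{\tau_n}=\mathbb 1]\le m\,B\Bigl(1+\frac1{k+1},\,m\Bigr).$$ -/

import Mathlib

noncomputable section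

namespace PathPower

/-- A directed path of `G`, given by the list of its vertices: the vertices are distinct and each
consecutive pair is an edge. Its length is the number of its vertices. -/
def IsDirectedPath {V : Type*} (G : Digraph V) (l : List V) : Prop :=
  l ≠ [] ∧ l.Nodup ∧ l.IsChain G.Adj

/-- The `k`th power of `G`: there is an edge from `v` to another vertex `w` if and only if `G` has
a directed path from `v` to `w` of length at most `k + 1`, that is, with at most `k + 1`
vertices. -/
def power {V : Type*} (G : Digraph V) (k : ℕ) : Digraph V where
  Adj v w := v ≠ w ∧ ∃ l : List V, IsDirectedPath G l ∧ l.head? = some v ∧ l.getLast? = some w ∧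
    l.length ≤ k + 1

/-- The directed path `v₁ ← v₂ ← ⋯ ← vₙ`; the vertex `vᵢ` is the element `i - 1` of `Fin n`. -/
def directedPath (n : ℕ) : Digraph (Fin n) where
  Adj v w := (w : ℕ) + 1 = v

/-- The `k`th power of the directed path with `n` vertices. -/
def pathPower (n k : ℕ) : Digraph (Fin n) := power (directedPath n) k

/-- A sink (maximal element) is a vertex without outgoing edges. -/
def IsSink {V : Type*} (G : Digraph V) (v : V) : Prop := ∀ w, ¬ G.Adj v w

/-- The subgraph of `G` induced by the set `S` of vertices. -/
def induced {V : Type*} (G : Digraph V) (S : Set V) : Digraph S where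
  Adj v w := G.Adj v w

/-- The simple graph that underlies `G` when directions are forgotten, so that connected components
of a directed graph make sense. -/
abbrev underlying {V : Type*} (G : Digraph V) : SimpleGraph V := G.toSimpleGraphInclusive

/-- The number of connected components. -/
def numComponents {V : Type*} (G : Digraph V) : ℕ := Nat.card (underlying G).ConnectedComponent

/-- An order of arrival of the vertices: the vertex `π i` arrives at time `i + 1`, so the times are
`1, …, n`. This is the set of the vertices that have arrived up to time `t`. -/
def arrived {n : ℕ} (π : Equiv.Perm (Fin n)) (t : ℕ) : Set (Fin n) := {v | (π.symm v : ℕ) < t}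

/-- The graph that the selector sees at time `t`, induced by the first `t` vertices. -/
def seen {n : ℕ} (k : ℕ) (π : Equiv.Perm (Fin n)) (t : ℕ) : Digraph (arrived π t) :=
  induced (pathPower n k) (arrived π t)

/-- The number of the vertices that have not yet arrived at time `t` and that lie, on the underlying
path, between two vertices of one and the same connected component of the graph seen at time `t`
(equivalently, between the two extreme vertices of a component). -/
def innerRemaining {n : ℕ} (k : ℕ) (π : Equiv.Perm (Fin n)) (t : ℕ) : ℕ :=
  Set.ncard {u : Fin n | u ∉ arrived π t ∧ ∃ w z : arrived π t,
    (underlying (seen k π t)).Reachable w z ∧ (w : Fin n) < u ∧ u < (z : Fin n)}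

/-- The stopping condition at time `t`, for `1 ≤ t ≤ n`: the number `n - t` of the vertices to come
equals `k (c - 1) + b`, where `c` is the number of components seen and `b` is the number of
remaining inner vertices, and the vertex arriving at time `t` is maximal in the graph seen. -/
def StopCondition {n : ℕ} (k : ℕ) (π : Equiv.Perm (Fin n)) (t : ℕ) : Prop :=
  ((n : ℤ) - t = k * ((numComponents (seen k π t) : ℤ) - 1) + innerRemaining k π t) ∧
    ∃ i : Fin n, (i : ℕ) + 1 = t ∧ ∃ h : π i ∈ arrived π t, IsSink (seen k π t) ⟨π i, h⟩

open Classical in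
/-- The stopping time: the first time at which the stopping condition holds, and `n` if there is no
such time. -/
def stopTime {n : ℕ} (k : ℕ) (π : Equiv.Perm (Fin n)) : ℕ :=
  if h : ∃ t, StopCondition k π t then Nat.find h else n

/-- The selector wins: the vertex arriving at the stopping time is the sink of the whole graph. -/
def Wins {n : ℕ} (k : ℕ) (π : Equiv.Perm (Fin n)) : Prop :=
  ∃ i : Fin n, (i : ℕ) + 1 = stopTime k π ∧ IsSink (pathPower n k) (π i)

/-- The probability that the selector wins when all `n!` orders of arrival are equally likely. -/
def successProb (n k : ℕ) : ℝ :=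
  (Nat.card {π : Equiv.Perm (Fin n) // Wins k π} : ℝ) / (n.factorial : ℝ)

/-- Euler's beta function. -/
def eulerBeta (a b : ℝ) : ℝ := ∫ x in (0 : ℝ)..1, x ^ (a - 1) * (1 - x) ^ (b - 1)

end PathPower

end

namespace PathPower

/-! Write `q = k + 1`. A win forces every window of `q` consecutive vertices that avoids `v₁` to
contain a vertex arriving before `v₁` (`exists_before_of_wins`). Indeed, when `v₁` is present, the
`k` vertices preceding each later component are missing, and so are the `b` inner ones. If a whole
window were missing too, its first vertex would be counted in neither group, so more than `k (c - 1)
+ b` vertices would be outstanding and the stopping condition would fail (`ncard_add_lt`).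

Take `m` disjoint windows. With independent uniform arrival times and `v₁` arriving at time `1 - x`,
each window has an earlier member with probability `1 - x ^ q`, so a win has probability at most `∫
(1 - x ^ q) ^ m` over `[0, 1]`; `card_perm_hit` proves this discretely by inclusion-exclusion. The
integral equals the beta expression of (b), and it is at most `m ^ (-1/q) Γ(1 + 1/q)`.

Since `n ≤ q (m + 2)`, part (a) reduces to maximising `q ^ (1/q) Γ(1 + 1/q)` over integers `q ≥ 2`.
The maximum is at `q = 3`, which is shown by separating all other values from it at 1.285. -/

/-! ### Adjacency in the path power. -/

theorem head_add_one_eq_of_isChain {n : ℕ} (l : List (Fin n)) (v w : Fin n)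
    (hc : l.IsChain (directedPath n).Adj) (hv : l.head? = some v) (hw : l.getLast? = some w) :
    (v : ℕ) + 1 = w + l.length := by
  induction l generalizing v with
  | nil => simp at hv
  | cons x l ih =>
    cases l with
    | nil => simp at hv hw; subst hv; subst hw; rfl
    | cons y l =>
      rw [List.isChain_cons_cons] at hc
      have h1 := ih y hc.2 rfl (by simpa using hw)
      have h2 : (y : ℕ) + 1 = x := hc.1
      simp at hv
      subst hv
      simp only [List.length_cons] at h1 ⊢
      omega

theorem exists_isChain_of_eq_add {n : ℕ} (w : Fin n) (d : ℕ) (v : Fin n) (h : (v : ℕ) = w + d) :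
    ∃ l : List (Fin n), l.IsChain (directedPath n).Adj ∧ l.head? = some v ∧
      l.getLast? = some w ∧ l.length = d + 1 ∧ l.Nodup ∧ ∀ x ∈ l, x ≤ v := by
  induction d generalizing v with
  | zero =>
    have : v = w := Fin.ext (by simpa using h)
    subst this
    exact ⟨[v], by simp, by simp, by simp, by simp, by simp, by simp⟩
  | succ d ih =>
    obtain ⟨l, h1, h2, h3, h4, h5, h6⟩ := ih ⟨w + d, by omega⟩ rfl
    have h0 : ∀ x ∈ l, (x : ℕ) ≤ w + d := fun x hx => h6 x hx
    refine ⟨v :: l, ?_, rfl, ?_, by simp [h4], ?_, ?_⟩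
    · cases l with
      | nil => simp at h2
      | cons y l =>
        simp at h2
        subst h2
        refine List.isChain_cons_cons.2 ⟨?_, h1⟩
        change (w : ℕ) + d + 1 = v
        omega
    · cases l with
      | nil => simp at h2
      | cons y l => simpa using h3
    · refine List.nodup_cons.2 ⟨fun hv => ?_, h5⟩
      have := h0 v hv
      omega
    · intro x hx
      rcases List.mem_cons.1 hx with rfl | hx
      · exact le_rfl
      · have := h0 x hx
        exact Fin.le_def.2 (by omega)

theorem pathPower_adj {n k : ℕ} {v w : Fin n} :
    (pathPower n k).Adj v w ↔ (w : ℕ) < v ∧ (v : ℕ) ≤ w + k := by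
  constructor
  · rintro ⟨hne, l, ⟨hl, -, hc⟩, hv, hw, hk⟩
    have h := head_add_one_eq_of_isChain l v w hc hv hw
    have hpos : 0 < l.length := List.length_pos_iff.2 hl
    have : (v : ℕ) ≠ w := fun h => hne (Fin.ext h)
    omega
  · rintro ⟨h1, h2⟩
    obtain ⟨l, hc, hv, hw, hlen, hnd, -⟩ := exists_isChain_of_eq_add w (v - w) v (by omega)
    refine ⟨fun h => by simp [h] at h1, l, ⟨?_, hnd, hc⟩, hv, hw, by omega⟩
    rintro rfl
    simp at hv

theorem isSink_pathPower {n k : ℕ} (hk : 1 ≤ k) {v : Fin n} (h : IsSink (pathPower n k) v) :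
    (v : ℕ) = 0 := by
  by_contra h0
  exact h ⟨v - 1, by omega⟩ (pathPower_adj.2 (by simp; omega))

theorem underlying_induced_adj {n k : ℕ} {S : Set (Fin n)} {x y : S} :
    (underlying (induced (pathPower n k) S)).Adj x y ↔ (x : Fin n) ≠ y ∧
      ((x : Fin n) : ℕ) ≤ (y : Fin n) + k ∧ ((y : Fin n) : ℕ) ≤ (x : Fin n) + k := by
  have : (underlying (induced (pathPower n k) S)).Adj x y ↔
      x ≠ y ∧ ((pathPower n k).Adj x y ∨ (pathPower n k).Adj y x) := Iff.rfl
  rw [this, pathPower_adj, pathPower_adj, Ne, Subtype.ext_iff, Ne, Fin.ext_iff]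
  omega

/-! ### Components and missing vertices. -/

/-- A missing vertex between two vertices of a component lies below an edge of the component. -/
theorem exists_edge_over {n k : ℕ} {S : Set (Fin n)} {w z : S} {u : Fin n} (hu : u ∉ S)
    (h : (underlying (induced (pathPower n k) S)).Reachable w z) (hw : (w : Fin n) < u)
    (hz : u < (z : Fin n)) :
    ∃ x ∈ S, ∃ y ∈ S, x < u ∧ u < y ∧ (y : ℕ) ≤ x + k := by
  obtain ⟨p⟩ := h
  induction p with
  | nil => exact absurd (hw.trans hz) (lt_irrefl _)
  | @cons x y z hxy p ih =>
    rcases lt_trichotomy (y : Fin n) u with hy | hy | hy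
    · exact ih hy hz
    · exact absurd (hy ▸ y.2) hu
    · exact ⟨x, x.2, y, y.2, hw, hy, (underlying_induced_adj.1 hxy).2.2⟩

/-- The missing vertices inside a component. -/
def inner {n : ℕ} (k : ℕ) (S : Set (Fin n)) : Set (Fin n) :=
  {u : Fin n | u ∉ S ∧ ∃ w z : S,
    (underlying (induced (pathPower n k) S)).Reachable w z ∧ (w : Fin n) < u ∧ u < (z : Fin n)}

/-- The vertices of `S`, other than the first vertex of the path, that have no member of `S` among
the `k` preceding vertices. -/
def starters {n : ℕ} (k : ℕ) (S : Set (Fin n)) : Set (Fin n) :=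
  {w | w ∈ S ∧ (w : ℕ) ≠ 0 ∧ ∀ s ∈ S, s < w → (s : ℕ) + k < w}

/-- The least vertex of a component is a starter unless it is `v₁`, and it determines the component.
-/
theorem numComponents_le {n k : ℕ} (S : Set (Fin n)) :
    numComponents (induced (pathPower n k) S) ≤ (starters k S).ncard + 1 := by
  classical
  have hmin : ∀ C : (underlying (induced (pathPower n k) S)).ConnectedComponent,
      ∃ w : S, w ∈ C.supp ∧ ∀ y ∈ C.supp, (w : Fin n) ≤ y := by
    intro C
    obtain ⟨w, hw, hm⟩ := Set.exists_min_image C.supp (fun y : S => (y : Fin n)) (Set.toFinite _)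
      C.nonempty_supp
    exact ⟨w, hw, hm⟩
  choose f hf hm using hmin
  have hinj : Function.Injective f := by
    intro C D h
    have h1 := hf C
    have h2 := hf D
    rw [SimpleGraph.ConnectedComponent.mem_supp_iff] at h1 h2
    rw [← h1, ← h2, h]
  have hsub : Set.range (fun C => ((f C : S) : Fin n)) ⊆
      starters k S ∪ {v : Fin n | (v : ℕ) = 0} := by
    rintro _ ⟨C, rfl⟩
    by_cases h0 : ((f C : Fin n) : ℕ) = 0
    · exact Or.inr h0
    refine Or.inl ⟨(f C).2, h0, fun s hs hlt => ?_⟩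
    by_contra hle
    have hadj : (underlying (induced (pathPower n k) S)).Adj (⟨s, hs⟩ : S) (f C) := by
      refine underlying_induced_adj.2 ⟨hlt.ne, ?_, by simpa using hle⟩
      have : (s : ℕ) < f C := hlt
      change (s : ℕ) ≤ _
      omega
    have hsC : (⟨s, hs⟩ : S) ∈ C.supp := by
      have h1 := hf C
      rw [SimpleGraph.ConnectedComponent.mem_supp_iff] at h1 ⊢
      rw [← h1]
      exact SimpleGraph.ConnectedComponent.sound hadj.reachable
    exact absurd (hm C _ hsC) (not_le.2 hlt)
  calc numComponents (induced (pathPower n k) S)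
      = (Set.range (fun C => ((f C : S) : Fin n))).ncard := by
        rw [← Set.image_univ, Set.ncard_image_of_injective _
          (show Function.Injective (fun C => ((f C : S) : Fin n)) from
            Subtype.val_injective.comp hinj), Set.ncard_univ]
        rfl
    _ ≤ (starters k S ∪ {v : Fin n | (v : ℕ) = 0}).ncard :=
        Set.ncard_le_ncard hsub (Set.toFinite _)
    _ ≤ (starters k S).ncard + {v : Fin n | (v : ℕ) = 0}.ncard := Set.ncard_union_le _ _
    _ ≤ (starters k S).ncard + 1 := by
        gcongr
        refine (Set.ncard_le_one (Set.toFinite _)).2 fun a ha b hb => Fin.ext ?_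
        exact Eq.trans ha (Eq.symm hb)

/-- If a window of `k + 1` consecutive vertices misses `S`, then more vertices are missing than
needed to fill the components and to separate them. -/
theorem ncard_add_lt {n k : ℕ} {S : Set (Fin n)} {z a : Fin n} (hz : (z : ℕ) = 0) (hzS : z ∈ S)
    (ha : ∀ u : Fin n, a ≤ u → (u : ℕ) ≤ a + k → u ∉ S) :
    k * (starters k S).ncard + (inner k S).ncard + S.ncard < n := by
  classical
  have hlow : ∀ w ∈ starters k S, k < (w : ℕ) := by
    intro w hw
    have := hw.2.2 z hzS (Fin.lt_def.2 (by have := hw.2.1; omega))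
    omega
  -- `G` consists of the `k` vertices just before each starter; by `hlow` the subtraction never
  -- truncates.
  let g : Fin n × Fin k → Fin n := fun p => ⟨p.1 - (p.2 + 1), by omega⟩
  let G : Set (Fin n) := g '' (starters k S ×ˢ Set.univ)
  have hg : ∀ p, (g p : ℕ) = p.1 - (p.2 + 1) := fun _ => rfl
  have hGmem : ∀ u ∈ G, ∃ w ∈ starters k S, u < w ∧ (w : ℕ) ≤ u + k := by
    rintro _ ⟨⟨w, j⟩, ⟨hw, -⟩, rfl⟩
    have h1 := hlow w hw
    have h2 := hg (w, j)
    have h3 := j.2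
    exact ⟨w, hw, Fin.lt_def.2 (by simp only at h2; omega), by simp only at h2; omega⟩
  have hGS : ∀ u ∈ G, u ∉ S := by
    intro u hu huS
    obtain ⟨w, hw, h1, h2⟩ := hGmem u hu
    have := hw.2.2 u huS h1
    omega
  have hGcard : G.ncard = k * (starters k S).ncard := by
    rw [Set.InjOn.ncard_image, Set.ncard_prod, Set.ncard_univ, Nat.card_fin, mul_comm]
    rintro ⟨w, i⟩ ⟨hw, -⟩ ⟨w', i'⟩ ⟨hw', -⟩ h
    have hval : (w : ℕ) - (i + 1) = w' - (i' + 1) := congrArg Fin.val h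
    have h1 : k < (w : ℕ) := hlow w hw
    have h2 : k < (w' : ℕ) := hlow w' hw'
    have h3 := i.2
    have h4 := i'.2
    have hww : w = w' := by
      rcases lt_trichotomy w w' with hlt | heq | hlt
      · have h5 : (w : ℕ) + k < w' := hw'.2.2 w hw.1 hlt
        omega
      · exact heq
      · have h5 : (w' : ℕ) + k < w := hw.2.2 w' hw'.1 hlt
        omega
    subst hww
    have : i = i' := Fin.ext (by omega)
    rw [this]
  -- An edge `x < u < y` over a vertex `u` of the gap before `w` would have `y ≥ w`, as no member of
  -- `S` lies in that gap; but `w > x + k`, so the edge is too long.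
  have hGinner : Disjoint G (inner k S) := by
    rw [Set.disjoint_left]
    rintro u hu ⟨huS, x', y', hr, hx, hy⟩
    obtain ⟨x, hxS, y, hyS, hxu, huy, hyx⟩ := exists_edge_over huS hr hx hy
    obtain ⟨w, hw, h1, h2⟩ := hGmem u hu
    have h3 := hw.2.2 x hxS (hxu.trans h1)
    have h4 : (w : ℕ) ≤ y := by
      by_contra hlt
      have := hw.2.2 y hyS (Fin.lt_def.2 (by omega))
      have : (u : ℕ) < y := huy
      omega
    omega
  have haS : a ∉ S := ha a le_rfl (by omega)
  have haG : a ∉ G := by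
    intro h
    obtain ⟨w, hw, h1, h2⟩ := hGmem a h
    exact ha w h1.le h2 hw.1
  have hainner : a ∉ inner k S := by
    rintro ⟨huS, x', y', hr, hx, hy⟩
    obtain ⟨x, hxS, y, hyS, hxu, huy, hyx⟩ := exists_edge_over huS hr hx hy
    have : (x : ℕ) < a := hxu
    exact ha y huy.le (by omega) hyS
  have hsub : insert a (G ∪ inner k S) ⊆ Sᶜ := by
    rintro u (rfl | hu | hu)
    · exact haS
    · exact hGS u hu
    · exact hu.1
  have hle := Set.ncard_le_ncard hsub (Set.toFinite _)
  rw [Set.ncard_insert_of_notMem (by simp [haG, hainner]) (Set.toFinite _),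
    Set.ncard_union_eq hGinner (Set.toFinite _) (Set.toFinite _), hGcard] at hle
  have htot := Set.ncard_add_ncard_compl S
  rw [Nat.card_fin] at htot
  omega

/-! ### Winning orders of arrival. -/

theorem ncard_arrived {n : ℕ} (π : Equiv.Perm (Fin n)) {t : ℕ} (ht : t ≤ n) :
    (arrived π t).ncard = t := by
  have : arrived π t = π '' {i | (i : ℕ) < t} := by
    ext v
    rw [Equiv.image_eq_preimage_symm]
    rfl
  rw [this, Set.ncard_image_of_injective _ π.injective]
  have h2 : {i : Fin n | (i : ℕ) < t} = Set.range (Fin.castLE ht) := by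
    ext i
    simp [Fin.range_castLE]
  rw [h2, ← Set.image_univ, Set.ncard_image_of_injective _ (Fin.castLE_injective ht),
    Set.ncard_univ, Nat.card_fin]

/-- If the selector wins, then every window of `k + 1` consecutive vertices after the first vertex
of the path contains a vertex that arrives before the first one. -/
theorem exists_before_of_wins {n k : ℕ} (hk : 1 ≤ k) {π : Equiv.Perm (Fin n)} (hπ : Wins k π)
    {z : Fin n} (hz : (z : ℕ) = 0) {a : ℕ} (ha : 1 ≤ a) (han : a + k < n) :
    ∃ u : Fin n, a ≤ u ∧ (u : ℕ) ≤ a + k ∧ π.symm u < π.symm z := by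
  classical
  obtain ⟨i, hi, hs⟩ := hπ
  have hzi : π i = z := Fin.ext ((isSink_pathPower hk hs).trans hz.symm)
  have hiz : π.symm z = i := by rw [← hzi, Equiv.symm_apply_apply]
  rw [hiz]
  by_contra! hcon
  by_cases hex : ∃ t, StopCondition k π t
  · rw [stopTime, dif_pos hex] at hi
    obtain ⟨hcond, -⟩ := Nat.find_spec hex
    rw [← hi] at hcond
    have hlt := ncard_add_lt (k := k) (S := arrived π (i + 1)) (z := z) (a := ⟨a, by omega⟩) hz
      (by change (π.symm z : ℕ) < i + 1; rw [hiz]; omega) (by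
        intro u h1 h2 hu
        have h3 : (π.symm u : ℕ) < i + 1 := hu
        have h4 := Fin.le_def.1 (hcon u h1 h2)
        have h5 : π.symm u = i := Fin.ext (by omega)
        have h6 : u = z := by rw [← hiz] at h5; exact π.symm.injective h5
        have h7 : a ≤ (u : ℕ) := h1
        rw [h6] at h7
        omega)
    rw [ncard_arrived π (by omega)] at hlt
    have hc : numComponents (seen k π (i + 1)) ≤ (starters k (arrived π (i + 1))).ncard + 1 :=
      numComponents_le (arrived π (i + 1))
    have hb : innerRemaining k π (i + 1) = (inner k (arrived π (i + 1))).ncard := rfl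
    rw [hb] at hcond
    have hmul : (k : ℤ) * ((numComponents (seen k π (i + 1)) : ℤ) - 1) ≤
        k * ((starters k (arrived π (i + 1))).ncard : ℤ) := by
      apply mul_le_mul_of_nonneg_left _ (by positivity)
      have : (numComponents (seen k π (i + 1)) : ℤ) ≤
        ((starters k (arrived π (i + 1))).ncard : ℤ) + 1 := by exact_mod_cast hc
      linarith
    zify at hlt
    push_cast at hcond
    linarith
  -- Here the default time `n` is used: `v₁` arrives last, so nothing in the window can arrive after
  -- it.
  · rw [stopTime, dif_neg hex] at hi
    have h1 := Fin.le_def.1 (hcon ⟨a, by omega⟩ le_rfl (by simp))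
    have h2 := (π.symm ⟨a, by omega⟩).2
    have h3 : π.symm ⟨a, by omega⟩ = i := Fin.ext (by omega)
    have h4 := congrArg Fin.val (π.symm.injective (h3.trans hiz.symm))
    simp only at h4
    omega

/-! ### Counting orders by inclusion-exclusion. -/

open Finset in
/-- In a uniformly random order, each element of a finite set is equally likely to be its first. -/
theorem card_perm_first_mul {α : Type*} [Fintype α] [LinearOrder α] (T : Finset α) (v : α)
    (hv : v ∉ T) :
    #{σ : Equiv.Perm α | ∀ u ∈ T, σ v < σ u} * (#T + 1) = (Fintype.card α).factorial := by
  classical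
  set F : α → Finset (Equiv.Perm α) := fun w => {σ | ∀ u ∈ insert v T, σ w ≤ σ u} with hF
  have hswap : ∀ w ∈ insert v T, #(F w) = #(F v) := by
    -- Precomposing with the transposition of `v` and `w` exchanges the orders led by `w` with those
    -- led by `v`.
    intro w hw
    refine card_bij' (fun σ _ => σ * Equiv.swap v w) (fun σ _ => σ * Equiv.swap v w)
      ?_ ?_ ?_ ?_
    · intro σ hσ
      simp only [hF, mem_filter, mem_univ, true_and] at hσ ⊢
      intro u hu
      simp only [Equiv.Perm.mul_apply, Equiv.swap_apply_left]
      apply hσ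
      by_cases h1 : u = v
      · subst h1; simpa using hw
      by_cases h2 : u = w
      · subst h2; simp
      rwa [Equiv.swap_apply_of_ne_of_ne h1 h2]
    · intro σ hσ
      simp only [hF, mem_filter, mem_univ, true_and] at hσ ⊢
      intro u hu
      simp only [Equiv.Perm.mul_apply, Equiv.swap_apply_right]
      apply hσ
      by_cases h1 : u = v
      · subst h1; simpa using hw
      by_cases h2 : u = w
      · subst h2; simp
      rwa [Equiv.swap_apply_of_ne_of_ne h1 h2]
    · intro σ _
      simp [mul_assoc]
    · intro σ _
      simp [mul_assoc]
  have hdisj : ∀ w ∈ insert v T, ∀ w' ∈ insert v T, w ≠ w' → Disjoint (F w) (F w') := by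
    intro w hw w' hw' hne
    rw [Finset.disjoint_left]
    intro σ h1 h2
    simp only [hF, mem_filter, mem_univ, true_and] at h1 h2
    exact hne (σ.injective (le_antisymm (h1 w' hw') (h2 w hw)))
  have hunion : (insert v T).biUnion F = univ := by
    rw [eq_univ_iff_forall]
    intro σ
    obtain ⟨w, hw, hm⟩ := exists_min_image (insert v T) σ ⟨v, mem_insert_self _ _⟩
    exact mem_biUnion.2 ⟨w, hw, by simpa [hF] using hm⟩
  have hsum := card_biUnion hdisj
  rw [hunion, sum_congr rfl hswap, sum_const, card_insert_of_notMem hv, card_univ,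
    Fintype.card_perm, smul_eq_mul, mul_comm] at hsum
  rw [hsum]
  congr 2
  ext σ
  simp only [hF, mem_filter, mem_univ, true_and, mem_insert, forall_eq_or_imp, le_refl]
  refine forall₂_congr fun u hu => ⟨le_of_lt, fun h => lt_of_le_of_ne h fun h' => hv ?_⟩
  rwa [σ.injective h']

open Finset in
/-- The probability that every one of `m` disjoint sets of size `q` has a member that comes before
`v` in a uniformly random order. -/
theorem card_perm_hit {α : Type*} [Fintype α] [LinearOrder α] (v : α) (m q : ℕ)
    (B : ℕ → Finset α) (hB : ∀ j < m, #(B j) = q)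
    (hd : ∀ i < m, ∀ j < m, i ≠ j → Disjoint (B i) (B j)) (hv : ∀ j < m, v ∉ B j) :
    (#{σ : Equiv.Perm α | ∀ j < m, ∃ u ∈ B j, σ u < σ v} : ℝ) =
      (Fintype.card α).factorial * ∫ x in (0 : ℝ)..1, (1 - x ^ q) ^ m := by
  classical
  have hind : ∀ σ : Equiv.Perm α,
      (if ∀ j < m, ∃ u ∈ B j, σ u < σ v then (1 : ℝ) else 0) =
        ∑ J ∈ (range m).powerset, (-1) ^ #J *
          if ∀ u ∈ J.biUnion B, σ v < σ u then (1 : ℝ) else 0 := by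
    intro σ
    have h1 : (if ∀ j < m, ∃ u ∈ B j, σ u < σ v then (1 : ℝ) else 0) =
        ∏ j ∈ range m, (1 + -(if ∀ u ∈ B j, σ v < σ u then (1 : ℝ) else 0)) := by
      have h2 : ∀ j ∈ range m, (1 + -(if ∀ u ∈ B j, σ v < σ u then (1 : ℝ) else 0)) =
          if ∃ u ∈ B j, σ u < σ v then (1 : ℝ) else 0 := by
        intro j hj
        have : (∀ u ∈ B j, σ v < σ u) ↔ ¬ ∃ u ∈ B j, σ u < σ v := by
          push Not
          refine forall₂_congr fun u hu => ⟨le_of_lt, fun h => lt_of_le_of_ne h fun h' => ?_⟩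
          exact hv j (mem_range.1 hj) (by rwa [σ.injective h'])
        by_cases h : ∃ u ∈ B j, σ u < σ v
        · rw [if_neg (by rw [this]; exact not_not.2 h), if_pos h]; simp
        · rw [if_pos (this.2 h), if_neg h]; simp
      rw [prod_congr rfl h2, prod_ite_zero]
      simp
    rw [h1, prod_one_add]
    refine sum_congr rfl fun J hJ => ?_
    rw [prod_neg, prod_ite_zero]
    congr 1
    simp only [prod_const_one, mem_biUnion]
    congr 1
    apply propext
    constructor
    · rintro h u ⟨j, hj, hu⟩
      exact h j hj u hu
    · intro h j hj u hu
      exact h u ⟨j, hj, hu⟩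
  -- The probability `1 / (q * #J + 1)` that `v` precedes the chosen blocks is written as an
  -- integral of a power of `x`, so that the alternating sum becomes a binomial expansion under the
  -- integral.
  have hJ : ∀ J ∈ (range m).powerset,
      (∑ σ : Equiv.Perm α, if ∀ u ∈ J.biUnion B, σ v < σ u then (1 : ℝ) else 0) =
        (Fintype.card α).factorial * ∫ x in (0 : ℝ)..1, (x ^ q) ^ #J := by
    intro J hJ
    have hlt : ∀ j ∈ J, j < m := fun j hj => mem_range.1 (mem_powerset.1 hJ hj)
    have hcard : #(J.biUnion B) = q * #J := by
      rw [card_biUnion (fun i hi j hj => hd i (hlt i hi) j (hlt j hj)),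
        sum_congr rfl fun j hj => hB j (hlt j hj), sum_const, smul_eq_mul, mul_comm]
    have hfirst := card_perm_first_mul (J.biUnion B) v (by
      simp only [mem_biUnion, not_exists, not_and]
      exact fun j hj => hv j (hlt j hj))
    rw [hcard] at hfirst
    rw [sum_boole, ← hfirst]
    simp_rw [← pow_mul]
    rw [integral_pow]
    push_cast
    field_simp
    simp
  calc (#{σ : Equiv.Perm α | ∀ j < m, ∃ u ∈ B j, σ u < σ v} : ℝ)
      = ∑ σ : Equiv.Perm α, ∑ J ∈ (range m).powerset, (-1) ^ #J *
          if ∀ u ∈ J.biUnion B, σ v < σ u then (1 : ℝ) else 0 := by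
        rw [← sum_boole]
        exact sum_congr rfl fun σ _ => hind σ
    _ = ∑ J ∈ (range m).powerset, (-1) ^ #J *
          ((Fintype.card α).factorial * ∫ x in (0 : ℝ)..1, (x ^ q) ^ #J) := by
        rw [sum_comm]
        refine sum_congr rfl fun J hJ' => ?_
        rw [← mul_sum, hJ J hJ']
    _ = (Fintype.card α).factorial *
          ∑ J ∈ (range m).powerset, ∫ x in (0 : ℝ)..1, (-1) ^ #J * (x ^ q) ^ #J := by
        rw [mul_sum]
        refine sum_congr rfl fun J _ => ?_
        rw [intervalIntegral.integral_const_mul]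
        ring
    _ = (Fintype.card α).factorial * ∫ x in (0 : ℝ)..1, (1 - x ^ q) ^ m := by
        rw [← intervalIntegral.integral_finsetSum]
        · congr 1
          refine intervalIntegral.integral_congr fun x _ => ?_
          have := prod_one_add (f := fun _ : ℕ => -x ^ q) (range m)
          simp only [prod_const, card_range] at this
          simp only [sub_eq_add_neg]
          rw [this]
          refine sum_congr rfl fun J _ => ?_
          rw [← mul_pow]
          simp
        · intro J _
          exact Continuous.intervalIntegrable (by fun_prop) _ _

open Finset in
theorem successProb_le_integral {n k : ℕ} (hk : 1 ≤ k) (hn : 0 < n) :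
    successProb n k ≤ ∫ x in (0 : ℝ)..1, (1 - x ^ (k + 1)) ^ ((n - 2) / (k + 1)) := by
  classical
  set q := k + 1 with hq
  set m := (n - 2) / q with hm
  have hmq : m * q ≤ n - 2 := Nat.div_mul_le_self _ _
  let v : Fin n := ⟨0, hn⟩
  -- The blocks start at index 1, so they avoid `v₁`.
  let B : ℕ → Finset (Fin n) := fun j => {u | 1 + j * q ≤ (u : ℕ) ∧ (u : ℕ) < 1 + (j + 1) * q}
  have hjm : ∀ j < m, (j + 1) * q ≤ n - 2 := fun j hj =>
    (Nat.mul_le_mul_right q hj).trans hmq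
  have hexp : ∀ j, (j + 1) * q = j * q + q := fun j => by ring
  have hcount := card_perm_hit v m q B ?_ ?_ ?_
  · rw [successProb, div_le_iff₀ (by positivity), mul_comm]
    rw [Fintype.card_fin] at hcount
    rw [← hcount]
    norm_cast
    rw [Nat.card_eq_fintype_card, Fintype.card_subtype]
    refine card_le_card_of_injOn (fun π => π.symm) ?_ (fun _ _ _ _ h => Equiv.symm_bijective.1 h)
    intro π hπ
    simp only [coe_filter, mem_univ, true_and, Set.mem_ofPred_eq] at hπ ⊢
    intro j hj
    have h1 := hjm j hj
    have h2 := hexp j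
    obtain ⟨u, hu1, hu2, hu3⟩ := exists_before_of_wins hk hπ (z := v) rfl
      (a := 1 + j * q) (by omega) (by omega)
    exact ⟨u, by simp only [B, mem_filter, mem_univ, true_and]; omega, hu3⟩
  · intro j hj
    have h1 := hjm j hj
    have h2 := hexp j
    rw [← card_map Fin.valEmbedding]
    have : (B j).map Fin.valEmbedding = Ico (1 + j * q) (1 + (j + 1) * q) := by
      ext x
      simp only [B, mem_map, mem_filter, mem_univ, true_and, Fin.valEmbedding_apply, mem_Ico]
      constructor
      · rintro ⟨u, hu, rfl⟩; exact hu
      · intro hx; exact ⟨⟨x, by omega⟩, hx, rfl⟩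
    rw [this, Nat.card_Ico]
    omega
  · intro i _ j _ hij
    rw [Finset.disjoint_left]
    intro u hu hu'
    simp only [B, mem_filter, mem_univ, true_and] at hu hu'
    have h1 := hexp i
    have h2 := hexp j
    rcases lt_or_gt_of_ne hij with h | h
    · have : (i + 1) * q ≤ j * q := Nat.mul_le_mul_right q h
      omega
    · have : (j + 1) * q ≤ i * q := Nat.mul_le_mul_right q h
      omega
  · intro j _
    simp [B, v]

/-! ### The integral in terms of beta and gamma functions. -/

/-- Integration by parts against `x`, then the substitution `y = x ^ q`. -/
theorem integral_one_sub_pow_pow {q m : ℕ} (hq : 1 ≤ q) (hm : 1 ≤ m) :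
    ∫ x in (0 : ℝ)..1, (1 - x ^ q) ^ m = m * eulerBeta (1 + 1 / (q : ℝ)) m := by
  obtain ⟨l, rfl⟩ : ∃ l, m = l + 1 := ⟨m - 1, by omega⟩
  have hq0 : (q : ℝ) ≠ 0 := by positivity
  have hderiv : ∀ x : ℝ, HasDerivAt (fun x : ℝ => (1 - x ^ q) ^ (l + 1))
      (((l + 1 : ℕ) : ℝ) * (1 - x ^ q) ^ l * (-(q * x ^ (q - 1)))) x := by
    intro x
    have h := ((hasDerivAt_pow q x).const_sub 1).pow (l + 1)
    convert! h using 1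
  have hparts := intervalIntegral.integral_mul_deriv_eq_deriv_mul (a := 0) (b := 1)
    (fun x _ => hderiv x) (fun x _ => hasDerivAt_id x)
    (Continuous.intervalIntegrable (by fun_prop) _ _)
    (Continuous.intervalIntegrable (by fun_prop) _ _)
  have hsub := intervalIntegral.integral_comp_mul_deriv (a := 0) (b := 1)
    (f := fun x : ℝ => x ^ q) (f' := fun x => q * x ^ (q - 1))
    (g := fun y : ℝ => y ^ (1 + 1 / (q : ℝ) - 1) * (1 - y) ^ (((l + 1 : ℕ) : ℝ) - 1))
    (fun x _ => hasDerivAt_pow q x) (by fun_prop) (by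
      apply Continuous.mul
      · exact Real.continuous_rpow_const (by simp)
      · exact (Real.continuous_rpow_const (by simp)).comp (by fun_prop))
  have hq' : q ≠ 0 := by omega
  simp only [mul_one, one_pow, sub_self, id, zero_pow hq', mul_zero, sub_zero] at hparts hsub
  rw [zero_pow (by omega)] at hparts
  rw [hparts, eulerBeta, ← hsub, ← intervalIntegral.integral_const_mul, zero_sub,
    ← intervalIntegral.integral_neg]
  refine intervalIntegral.integral_congr fun x hx => ?_
  rw [Set.uIcc_of_le zero_le_one] at hx
  have h1 : (x ^ q) ^ (1 + 1 / (q : ℝ) - 1) = x := by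
    rw [add_sub_cancel_left, one_div]
    exact Real.pow_rpow_inv_natCast hx.1 hq'
  have h2 : (1 - x ^ q) ^ (((l + 1 : ℕ) : ℝ) - 1) = (1 - x ^ q) ^ l := by
    push_cast
    rw [add_sub_cancel_right, Real.rpow_natCast]
  simp only [Function.comp, h1, h2]
  ring

/-- Uses `1 - y ≤ exp (-y)` and extends the integral to the half-line. -/
theorem integral_one_sub_pow_pow_le {q m : ℕ} (hq : 1 ≤ q) (hm : 1 ≤ m) :
    ∫ x in (0 : ℝ)..1, (1 - x ^ q) ^ m ≤
      (m : ℝ) ^ (-1 / (q : ℝ)) * Real.Gamma (1 / q + 1) := by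
  have hq0 : (0 : ℝ) < q := by positivity
  have hm0 : (0 : ℝ) < m := by positivity
  rw [← integral_exp_neg_mul_rpow hq0 hm0]
  have hint : MeasureTheory.IntegrableOn (fun x : ℝ => Real.exp (-m * x ^ (q : ℝ)))
      (Set.Ioi 0) := by
    have := integrableOn_rpow_mul_exp_neg_mul_rpow (s := 0) (p := q) (b := m) (by norm_num)
      (by exact_mod_cast hq) hm0
    simpa using this
  rw [intervalIntegral.integral_of_le zero_le_one]
  calc ∫ x in Set.Ioc (0 : ℝ) 1, (1 - x ^ q) ^ m
      ≤ ∫ x in Set.Ioc (0 : ℝ) 1, Real.exp (-m * x ^ (q : ℝ)) := by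
        refine MeasureTheory.setIntegral_mono_on ?_ (hint.mono_set Set.Ioc_subset_Ioi_self)
          measurableSet_Ioc fun x hx => ?_
        · exact (Continuous.integrableOn_Icc (by fun_prop)).mono_set Set.Ioc_subset_Icc_self
        · rw [Real.rpow_natCast, neg_mul_comm, Real.exp_nat_mul]
          refine pow_le_pow_left₀ ?_ ?_ m
          · exact sub_nonneg.2 (pow_le_one₀ hx.1.le hx.2)
          · linarith [Real.add_one_le_exp (-x ^ q)]
    _ ≤ ∫ x in Set.Ioi (0 : ℝ), Real.exp (-m * x ^ (q : ℝ)) :=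
        MeasureTheory.setIntegral_mono_set hint
          (Filter.Eventually.of_forall fun x => (Real.exp_pos _).le)
          (Filter.Eventually.of_forall Set.Ioc_subset_Ioi_self)

/-! ### Rational bounds for the gamma values. -/

theorem Gamma_one_add_inv_mul_prod {q : ℕ} (hq : 1 ≤ q) (N : ℕ) :
    Real.Gamma (N + 1 + 1 / q) =
      Real.Gamma (1 / q + 1) * ((∏ j ∈ Finset.range N, (q * (j + 1) + 1) : ℕ) : ℝ) / q ^ N := by
  have hq0 : (0 : ℝ) < q := by positivity
  induction N with
  | zero => simp [add_comm]
  | succ N ih =>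
    have h : ((N + 1 : ℕ) : ℝ) + 1 + 1 / q = (N + 1 + 1 / q) + 1 := by push_cast; ring
    rw [h, Real.Gamma_add_one (by positivity), ih, Finset.prod_range_succ]
    push_cast
    field_simp
    ring

/-- Log-convexity of `Γ` at `N + 1 + 1/q`, between `N + 1` and `N + 2`. Larger `N` sharpens the
bound, and `q`th powers keep it free of roots. -/
theorem Gamma_pow_mul_le {q : ℕ} (hq : 2 ≤ q) (N : ℕ) :
    Real.Gamma (1 / q + 1) ^ q * ((∏ j ∈ Finset.range N, (q * (j + 1) + 1) : ℕ) : ℝ) ^ q ≤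
      (N + 1) * (N.factorial * q ^ N) ^ q := by
  have hq0 : (0 : ℝ) < q := by positivity
  have hq1 : (1 : ℝ) / q < 1 := by
    rw [div_lt_one hq0]; exact_mod_cast hq
  have hq2 : (0 : ℝ) < 1 / q := by positivity
  have h := Real.Gamma_mul_add_mul_le_rpow_Gamma_mul_rpow_Gamma (s := N + 1) (t := N + 1 + 1)
    (a := 1 - 1 / q) (b := 1 / q) (by positivity) (by positivity) (by linarith) hq2 (by ring)
  have e : (1 - 1 / (q : ℝ)) * (N + 1) + 1 / q * (N + 1 + 1) = N + 1 + 1 / q := by ring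
  have hG : (0 : ℝ) < N.factorial := by positivity
  rw [e, Gamma_one_add_inv_mul_prod (by omega), Real.Gamma_add_one (s := (N : ℝ) + 1) (by positivity),
    Real.Gamma_nat_eq_factorial, Real.mul_rpow (by positivity) hG.le, mul_left_comm,
    ← Real.rpow_add hG, sub_add_cancel, Real.rpow_one, div_le_iff₀ (by positivity)] at h
  have h2 := pow_le_pow_left₀ (by have := Real.Gamma_pos_of_pos (s := 1 / q + 1) (by positivity); positivity) h q
  rw [mul_pow] at h2
  refine h2.trans (le_of_eq ?_)
  rw [mul_assoc, mul_pow, ← Real.rpow_natCast, ← Real.rpow_mul (by positivity),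
    one_div_mul_cancel hq0.ne', Real.rpow_one]

/-- The matching lower bound: log-convexity at `N + 1`, between `N + 1/3` and `N + 4/3`. -/
theorem le_Gamma_four_thirds_pow_mul (N : ℕ) :
    (3 * N + 1) * (N.factorial * 3 ^ N) ^ 3 ≤
      3 * Real.Gamma (4 / 3) ^ 3 *
        ((∏ j ∈ Finset.range N, (3 * (j + 1) + 1) : ℕ) : ℝ) ^ 3 := by
  have h := Real.Gamma_mul_add_mul_le_rpow_Gamma_mul_rpow_Gamma (s := N + 1 / 3)
    (t := N + 1 + 1 / 3) (a := 1 / 3) (b := 2 / 3) (by positivity) (by positivity)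
    (by norm_num) (by norm_num) (by norm_num)
  have e : (1 / 3 : ℝ) * (N + 1 / 3) + 2 / 3 * (N + 1 + 1 / 3) = N + 1 := by ring
  have hP := Gamma_one_add_inv_mul_prod (q := 3) (by norm_num) N
  have hs : Real.Gamma (N + 1 + 1 / 3) = (N + 1 / 3) * Real.Gamma (N + 1 / 3) := by
    rw [← Real.Gamma_add_one (by positivity)]
    ring_nf
  have hpos : 0 < Real.Gamma (N + 1 / 3) := Real.Gamma_pos_of_pos (by positivity)
  push_cast at hP
  rw [show (1 / 3 + 1 : ℝ) = 4 / 3 by norm_num] at hP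
  rw [e, Real.Gamma_nat_eq_factorial] at h
  have h3 := pow_le_pow_left₀ (by positivity) h 3
  rw [mul_pow, ← Real.rpow_mul_natCast hpos.le, ← Real.rpow_mul_natCast
    (Real.Gamma_pos_of_pos (by positivity)).le] at h3
  norm_num at h3
  rw [show (1 / 3 : ℝ) = 1 / 3 from rfl] at h3
  have h4 : ((N : ℝ) + 1 / 3) * (N.factorial : ℝ) ^ 3 ≤ Real.Gamma (N + 1 + 1 / 3) ^ 3 := by
    calc ((N : ℝ) + 1 / 3) * (N.factorial : ℝ) ^ 3
        ≤ ((N : ℝ) + 1 / 3) * (Real.Gamma (N + 1 / 3) * Real.Gamma (N + 1 + 1 / 3) ^ 2) := by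
          gcongr
      _ = Real.Gamma (N + 1 + 1 / 3) ^ 3 := by rw [hs]; ring
  rw [hP, div_pow, le_div_iff₀ (by positivity)] at h4
  push_cast
  nlinarith [h4]

theorem Gamma_pow_le_one {q : ℕ} (hq : 2 ≤ q) : Real.Gamma (1 / q + 1) ^ q ≤ 1 := by
  simpa using Gamma_pow_mul_le hq 0

theorem mul_Gamma_pow_le_of_le {q : ℕ} (hq : 2 ≤ q) (N : ℕ) {a b : ℕ} (hb : 0 < b)
    (h : q * (N + 1) * (N.factorial * q ^ N * b) ^ q ≤
      (a * ∏ j ∈ Finset.range N, (q * (j + 1) + 1)) ^ q) :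
    q * Real.Gamma (1 / q + 1) ^ q ≤ ((a : ℝ) / b) ^ q := by
  have h1 := Gamma_pow_mul_le hq N
  set P := ∏ j ∈ Finset.range N, (q * (j + 1) + 1) with hP
  have hPpos : 0 < P := Finset.prod_pos fun j _ => by positivity
  have hP0 : (0 : ℝ) < (P : ℝ) ^ q := by positivity
  have h2 : (q : ℝ) * (N + 1) * (N.factorial * q ^ N * b) ^ q ≤ (a * P) ^ q := by exact_mod_cast h
  rw [div_pow, le_div_iff₀ (by positivity)]
  refine le_of_mul_le_mul_right ?_ hP0
  calc q * Real.Gamma (1 / q + 1) ^ q * (b : ℝ) ^ q * (P : ℝ) ^ q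
      = q * (b : ℝ) ^ q * (Real.Gamma (1 / q + 1) ^ q * (P : ℝ) ^ q) := by ring
    _ ≤ q * (b : ℝ) ^ q * ((N + 1) * (N.factorial * q ^ N) ^ q) := by gcongr
    _ = q * (N + 1) * (N.factorial * q ^ N * b) ^ q := by rw [mul_pow _ (b : ℝ)]; ring
    _ ≤ (a * P) ^ q := h2
    _ = (a : ℝ) ^ q * (P : ℝ) ^ q := mul_pow _ _ _

theorem le_pow_of_nine_le {q : ℕ} (hq : 9 ≤ q) : (q : ℝ) ≤ 1.285 ^ q := by
  induction q, hq using Nat.le_induction with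
  | base => norm_num
  | succ q hq ih =>
    have : (9 : ℝ) ≤ q := by exact_mod_cast hq
    rw [pow_succ]
    push_cast
    linarith

theorem three_mul_le_pow {q : ℕ} (hq : 17 ≤ q) : 3 * (q : ℝ) ≤ 1.285 ^ q := by
  induction q, hq using Nat.le_induction with
  | base => norm_num
  | succ q hq ih =>
    have : (17 : ℝ) ≤ q := by exact_mod_cast hq
    rw [pow_succ]
    push_cast
    linarith

theorem mul_Gamma_pow_le {q : ℕ} (hq : 2 ≤ q) (hq3 : q ≠ 3) :
    q * Real.Gamma (1 / q + 1) ^ q ≤ 1.285 ^ q := by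
  rcases le_or_gt 9 q with h9 | h9
  · calc q * Real.Gamma (1 / q + 1) ^ q ≤ q * 1 := by
          gcongr
          exact Gamma_pow_le_one hq
      _ ≤ 1.285 ^ q := by rw [mul_one]; exact le_pow_of_nine_le h9
  -- As `1.285 = 257 / 200`, each remaining `q` becomes an inequality of natural numbers.
  · have key : ∀ N : ℕ, q * (N + 1) * (N.factorial * q ^ N * 200) ^ q ≤
        (257 * ∏ j ∈ Finset.range N, (q * (j + 1) + 1)) ^ q →
        q * Real.Gamma (1 / q + 1) ^ q ≤ 1.285 ^ q := by
      intro N hN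
      have := mul_Gamma_pow_le_of_le hq N (a := 257) (b := 200) (by norm_num) hN
      norm_num at this ⊢
      exact this
    interval_cases q
    · exact key 6 (by decide +kernel)
    · exact absurd rfl hq3
    -- For `q = 4` the root `q ^ (1/q) Γ(1 + 1/q)` is about 1.2818, close to 1.285, hence the large
    -- `N`.
    · exact key 45 (by decide +kernel)
    all_goals exact key 6 (by decide +kernel)

/-- The value `Γ(4/3) 3^(1/3)` of `q^(1/q) Γ(1 + 1/q)` at `q = 3`. -/
noncomputable def limitConst : ℝ := Real.Gamma (4 / 3) * (3 : ℝ) ^ (1 / 3 : ℝ)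

theorem limitConst_pos : 0 < limitConst :=
  mul_pos (Real.Gamma_pos_of_pos (by norm_num)) (by positivity)

theorem limitConst_pow : limitConst ^ 3 = 3 * Real.Gamma (4 / 3) ^ 3 := by
  rw [limitConst, mul_pow, ← Real.rpow_mul_natCast (by norm_num)]
  norm_num
  ring

theorem limitConst_gt : 1.285 < limitConst := by
  refine lt_of_pow_lt_pow_left₀ 3 limitConst_pos.le ?_
  rw [limitConst_pow]
  have h := le_Gamma_four_thirds_pow_mul 80
  set P := ∏ j ∈ Finset.range 80, (3 * (j + 1) + 1) with hP
  have hnum : (257 * P) ^ 3 < (3 * 80 + 1) * (Nat.factorial 80 * 3 ^ 80 * 200) ^ 3 := by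
    rw [hP]
    decide +kernel
  have hPpos : 0 < P := Finset.prod_pos fun j _ => by positivity
  have hP0 : (0 : ℝ) < (P : ℝ) ^ 3 := by positivity
  have hnum' : ((257 : ℝ) * P) ^ 3 < (3 * 80 + 1) * (Nat.factorial 80 * 3 ^ 80 * 200) ^ 3 := by
    exact_mod_cast hnum
  push_cast at h
  rw [mul_pow, mul_pow _ (200 : ℝ), ← mul_assoc] at hnum'
  refine lt_of_mul_lt_mul_right ?_ hP0.le
  refine lt_of_lt_of_le ?_ h
  have e : (1.285 : ℝ) ^ 3 = 257 ^ 3 / 200 ^ 3 := by norm_num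
  rw [e, div_mul_eq_mul_div, div_lt_iff₀ (by norm_num)]
  exact hnum'

theorem limitConst_lt : limitConst < 1.295 := by
  refine lt_of_pow_lt_pow_left₀ 3 (by norm_num) ?_
  rw [limitConst_pow]
  have h := mul_Gamma_pow_le_of_le (q := 3) (by norm_num) 30 (a := 2589) (b := 2000) (by norm_num)
    (by decide +kernel)
  push_cast at h
  rw [show (1 / 3 + 1 : ℝ) = 4 / 3 by norm_num] at h
  refine h.trans_lt (by norm_num)

theorem mul_Gamma_pow_le_limitConst_pow {q : ℕ} (hq : 2 ≤ q) :
    q * Real.Gamma (1 / q + 1) ^ q ≤ limitConst ^ q := by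
  by_cases h3 : q = 3
  · subst h3
    rw [limitConst_pow]
    norm_num
  · exact (mul_Gamma_pow_le hq h3).trans
      (pow_le_pow_left₀ (by norm_num) limitConst_gt.le q)

/-! ### The bound uniform in `k`. -/

theorem successProb_nonneg (n k : ℕ) : 0 ≤ successProb n k := by
  unfold successProb
  positivity

theorem successProb_pow_mul_le {n k : ℕ} (hk : 1 ≤ k) (hn : k + 2 < n) :
    successProb n k ^ (k + 1) * ((n - 2) / (k + 1) : ℕ) ≤
      Real.Gamma (1 / (k + 1 : ℕ) + 1) ^ (k + 1) := by
  set q := k + 1 with hq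
  set m := (n - 2) / q with hm
  have hm1 : 1 ≤ m := (Nat.one_le_div_iff (by omega)).2 (by omega)
  have hm0 : (0 : ℝ) < m := by positivity
  have hq0 : (q : ℝ) ≠ 0 := by positivity
  have h := (successProb_le_integral hk (by omega)).trans
    (integral_one_sub_pow_pow_le (q := q) (by omega) hm1)
  have h2 := pow_le_pow_left₀ (successProb_nonneg n k) h q
  rw [mul_pow, ← Real.rpow_mul_natCast hm0.le, div_mul_cancel₀ _ hq0, Real.rpow_neg_one] at h2
  calc successProb n k ^ q * m
      ≤ (m : ℝ)⁻¹ * Real.Gamma (1 / q + 1) ^ q * m := by gcongr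
    _ = Real.Gamma (1 / q + 1) ^ q := by field_simp

theorem successProb_le_one {n k : ℕ} : successProb n k ≤ 1 := by
  classical
  rw [successProb, div_le_one (by positivity)]
  have := Nat.card_le_card_of_injective (Subtype.val : {π : Equiv.Perm (Fin n) // Wins k π} → _)
    Subtype.val_injective
  rw [Nat.card_perm, Nat.card_fin] at this
  exact_mod_cast this

theorem rpow_mul_successProb_le_of_pow_le {n k : ℕ} {c : ℝ} (hc : 0 ≤ c)
    (h : n * successProb n k ^ (k + 1) ≤ c ^ (k + 1)) :
    (n : ℝ) ^ (1 / ((k : ℝ) + 1)) * successProb n k ≤ c := by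
  refine le_of_pow_le_pow_left₀ (Nat.succ_ne_zero k) hc ?_
  rw [mul_pow, ← Real.rpow_mul_natCast (by positivity), Nat.succ_eq_add_one]
  push_cast
  rw [one_div_mul_cancel (by positivity), Real.rpow_one]
  exact h

/-- For small `q` the loss `1 + 2/m` tends to 1 as `n` grows. For large `q` it may stay as large as
3, but `3 q ≤ 1.285 ^ q` absorbs it. -/
theorem rpow_mul_successProb_le {n k : ℕ} (hk : 1 ≤ k) (hkn : k < n) (hn : 64 ≤ n) :
    (n : ℝ) ^ (1 / ((k : ℝ) + 1)) * successProb n k ≤ limitConst * (1 + 64 / n) := by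
  have hC := limitConst_pos
  have hn0 : (0 : ℝ) < n := by positivity
  have hP := successProb_nonneg n k
  refine rpow_mul_successProb_le_of_pow_le (by positivity) ?_
  have hpow : limitConst ^ (k + 1) ≤ (limitConst * (1 + 64 / n)) ^ (k + 1) := by
    gcongr
    exact le_mul_of_one_le_right hC.le (le_add_of_nonneg_right (by positivity))
  have h1285 : (1.285 : ℝ) ^ (k + 1) ≤ limitConst ^ (k + 1) :=
    pow_le_pow_left₀ (by norm_num) limitConst_gt.le _
  by_cases hlt : k + 2 < n
  · have hPm := successProb_pow_mul_le hk hlt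
    have hG := mul_Gamma_pow_le_limitConst_pow (q := k + 1) (by omega)
    have hG1 := Gamma_pow_le_one (q := k + 1) (by omega)
    have h17 := three_mul_le_pow (q := k + 1)
    set q := k + 1 with hq
    set m := (n - 2) / q with hm
    have hm1 : 1 ≤ m := (Nat.one_le_div_iff (by omega)).2 (by omega)
    have hm0 : (0 : ℝ) < m := by positivity
    have hm1' : (1 : ℝ) ≤ m := by exact_mod_cast hm1
    have hnm : n ≤ q * (m + 2) := by
      have h1 : n - 2 < q * (m + 1) := Nat.lt_mul_div_succ _ (by omega)
      have h2 : q * (m + 2) = q * (m + 1) + q := by ring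
      omega
    have hnm' : (n : ℝ) ≤ q * (m + 2) := by exact_mod_cast hnm
    have hmain : n * successProb n k ^ q ≤ q * Real.Gamma (1 / q + 1) ^ q * (1 + 2 / m) := by
      calc n * successProb n k ^ q ≤ q * (m + 2) * successProb n k ^ q := by gcongr
        _ = q * (1 + 2 / m) * (successProb n k ^ q * m) := by field_simp
        _ ≤ q * (1 + 2 / m) * Real.Gamma (1 / q + 1) ^ q := by gcongr
        _ = q * Real.Gamma (1 / q + 1) ^ q * (1 + 2 / m) := by ring
    rcases le_or_gt 17 q with hbig | hsmall
    · have h3 : (1 : ℝ) + 2 / m ≤ 3 := by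
        have : 2 / (m : ℝ) ≤ 2 := div_le_self (by norm_num) hm1'
        linarith
      calc n * successProb n k ^ q ≤ q * Real.Gamma (1 / q + 1) ^ q * (1 + 2 / m) := hmain
        _ ≤ q * 1 * 3 := by gcongr
        _ = 3 * q := by ring
        _ ≤ _ := (h17 hbig).trans (h1285.trans hpow)
    -- From `64 ≤ n ≤ 16 (m + 2)` follows `m ≥ 2`, hence `16 (m + 2) ≤ 32 m`.
    · have hmn : n ≤ 32 * m := by
        have : q * (m + 2) ≤ 16 * (m + 2) := Nat.mul_le_mul_right _ (by omega)
        omega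
      have hmn' : (n : ℝ) ≤ 32 * m := by exact_mod_cast hmn
      have h64 : 2 / (m : ℝ) ≤ 64 / n := by
        rw [div_le_div_iff₀ hm0 hn0]
        linarith
      calc n * successProb n k ^ q ≤ q * Real.Gamma (1 / q + 1) ^ q * (1 + 2 / m) := hmain
        _ ≤ limitConst ^ q * (1 + 64 / n) := by gcongr
        _ ≤ limitConst ^ q * (1 + 64 / n) ^ q := by
            gcongr
            exact le_self_pow₀ (le_add_of_nonneg_right (by positivity)) (by omega)
        _ = _ := (mul_pow _ _ _).symm
  · have hnk : (n : ℝ) ≤ 3 * ((k + 1 : ℕ) : ℝ) := by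
      have : n ≤ 3 * (k + 1) := by omega
      exact_mod_cast this
    calc n * successProb n k ^ (k + 1) ≤ 3 * ((k + 1 : ℕ) : ℝ) * 1 := by
          gcongr
          exact pow_le_one₀ hP successProb_le_one
      _ = 3 * ((k + 1 : ℕ) : ℝ) := mul_one _
      _ ≤ _ := (three_mul_le_pow (by omega)).trans (h1285.trans hpow)

end PathPower

theorem mainTheorem3 :
    (∃ C : ℝ, 0 < C ∧ C = Real.Gamma (4 / 3) * (3 : ℝ) ^ (1 / 3 : ℝ) ∧ |C - 1.29| < 0.005 ∧
      ∀ k : ℕ → ℕ, (∀ n : ℕ, 2 ≤ n → 1 ≤ k n ∧ k n < n) →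
        Filter.limsup
          (fun n : ℕ =>
            (((n : ℝ) ^ (1 / ((k n : ℝ) + 1)) * PathPower.successProb n (k n) : ℝ) : EReal))
          Filter.atTop ≤ (C : EReal)) ∧
    (∀ n k : ℕ, 1 ≤ k → k + 2 < n →
      PathPower.successProb n k ≤
        (((n - 2) / (k + 1) : ℕ) : ℝ) *
          PathPower.eulerBeta (1 + 1 / ((k : ℝ) + 1)) (((n - 2) / (k + 1) : ℕ) : ℝ)) := by
  refine ⟨⟨PathPower.limitConst, PathPower.limitConst_pos, rfl, ?_, fun k hk => ?_⟩,
    fun n k hk hn => ?_⟩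
  · have h1 := PathPower.limitConst_gt
    have h2 := PathPower.limitConst_lt
    rw [abs_lt]
    constructor <;> linarith
  · have hlim : Filter.Tendsto
        (fun n : ℕ => ((PathPower.limitConst * (1 + 64 / (n : ℝ)) : ℝ) : EReal))
        Filter.atTop (nhds (PathPower.limitConst : EReal)) := by
      refine (continuous_coe_real_ereal.tendsto _).comp ?_
      have := ((tendsto_const_div_atTop_nhds_zero_nat (64 : ℝ)).const_add 1).const_mul
        PathPower.limitConst
      simpa using this
    rw [← hlim.limsup_eq]
    refine Filter.limsup_le_limsup ?_
    filter_upwards [Filter.eventually_ge_atTop 64] with n hn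
    have := hk n (by omega)
    exact EReal.coe_le_coe (PathPower.rpow_mul_successProb_le this.1 this.2 hn)
  · have hm : 1 ≤ (n - 2) / (k + 1) := (Nat.one_le_div_iff (by omega)).2 (by omega)
    have h := PathPower.successProb_le_integral hk (show 0 < n by omega)
    rw [PathPower.integral_one_sub_pow_pow (by omega) hm] at h
    push_cast at h
    exact_mod_cast h
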